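/- Let $m\ge 0$, $n\ge 1$, let $\mathbb{R}^m_{>0}$ be the set of vectors in $\mathbb{R}^m$ with positive components and $\mathbb{S}^n$ the space of real symmetric $n\times n$ matrices. For $X,Y\in\mathbb{S}^n$ with $Y$ positive definite, a generalized eigenvalue of $(X,Y)$ is a number $\lambda\in\mathbb{R}$ with $Xv=\lambda Yv$ for some nonzero $v\in\mathbb{R}^n$, its multiplicity is the dimension of $\{v\in\mathbb{R}^n : Xv=\lambda Yv\}$, and $\lambda_1(X,Y)$ is the largest generalized eigenvalue. For a locally Lipschitz function $f$ on an open subset of $\mathbb{R}^m$, the Clarke subdifferential at a point $x$ of that set is $$\partial f(x)=\operatorname{conv}\Bigl\{\lim_{i\to\infty}\nabla f(x^i) \;:\; x^i\to x,\ f \text{ differentiable at each } x^i\Bigr\},$$ where only sequences for which the limit of the gradients exists are considered. Let $A,B:\mathbb{R}^m_{>0}\to\mathbb{S}^n$ be continuously differentiable with $B(y)\succ 0$ for every $y\in\mathbb{R}^m_{>0}$, and put $\lambda_1^{A,B}(y)=\lambda_1(A(y),B(y))$. Then $\lambda_1^{A,B}$ is locally Lipschitz on $\mathbb{R}^m_{>0}$.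 Moreover, let $x\in\mathbb{R}^m_{>0}$, let $t$ be the multiplicity of the maximum generalized eigenvalue $\lambda_1^{A,B}(x)$ of $(A(x),B(x))$, and let $V=[v_1,\dots,v_t]\in\mathbb{R}^{n\times t}$ be any matrix whose columns are corresponding generalized eigenvectors, i.e. $A(x)v_k=\lambda_1^{A,B}(x)B(x)v_k$ for $k=1,\dots,t$, with $V^{\mathrm T}B(x)V=I$. Then $$\partial\lambda_1^{A,B}(x)=\left\{\left[\left\langle U,\;V^{\mathrm T}\left(\frac{\partial A(x)}{\partial x_e}-\lambda_1^{A,B}(x)\,\frac{\partial B(x)}{\partial x_e}\right)V\right\rangle\right]_{e=1}^m \;:\; U\in\Upsilon_t\right\},$$ where $\langle P,Q\rangle=\operatorname{tr}(PQ)$, $\Upsilon_t=\{U\in\mathbb{S}^t : U\succeq 0,\ \operatorname{tr}U=1\}$, and $[a_e]_{e=1}^m$ is the vector in $\mathbb{R}^m$ with components $a_e$. -/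

import Mathlib

open Filter Topology

/-- The open orthant `ℝ^m_{>0}` of vectors with positive components. -/
def posOrthant (m : ℕ) : Set (EuclideanSpace ℝ (Fin m)) :=
  {x | ∀ e, 0 < x e}

/-- `μ` is a generalized eigenvalue of the pair `(X, Y)`: `X v = μ Y v` for some nonzero `v`. -/
def IsGenEigenvalue {n : ℕ} (X Y : Matrix (Fin n) (Fin n) ℝ) (μ : ℝ) : Prop :=
  ∃ v : Fin n → ℝ, v ≠ 0 ∧ X.mulVec v = μ • Y.mulVec v

/-- The maximum generalized eigenvalue `λ₁(X, Y)`. For symmetric `X`, positive definite `Y` and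
`n ≥ 1`, the set of generalized eigenvalues is finite and nonempty, so this is its maximum. -/
noncomputable def maxGenEigenvalue {n : ℕ} (X Y : Matrix (Fin n) (Fin n) ℝ) : ℝ :=
  sSup {μ : ℝ | IsGenEigenvalue X Y μ}

/-- The multiplicity of `μ` as a generalized eigenvalue of `(X, Y)`: the dimension of
`{v | X v = μ Y v}`. -/
noncomputable def genEigenvalueMultiplicity {n : ℕ} (X Y : Matrix (Fin n) (Fin n) ℝ) (μ : ℝ) : ℕ :=
  Module.finrank ℝ (LinearMap.ker (Matrix.mulVecLin (X - μ • Y)))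

/-- The function `x ↦ λ₁(A(x), B(x))`. -/
noncomputable def maxGenEigenvalueFun {m n : ℕ}
    (A B : EuclideanSpace ℝ (Fin m) → Matrix (Fin n) (Fin n) ℝ) :
    EuclideanSpace ℝ (Fin m) → ℝ :=
  fun x => maxGenEigenvalue (A x) (B x)

/-- A matrix-valued map is `C¹` on a set if all its entries are. -/
def MatrixC1On {m n : ℕ} (A : EuclideanSpace ℝ (Fin m) → Matrix (Fin n) (Fin n) ℝ)
    (Ω : Set (EuclideanSpace ℝ (Fin m))) : Prop :=
  ∀ i j, ContDiffOn ℝ 1 (fun x => A x i j) Ω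

/-- The (entrywise) partial derivative `∂A(x)/∂x_e` of a matrix-valued map. -/
noncomputable def matrixPartialDeriv {m n : ℕ}
    (A : EuclideanSpace ℝ (Fin m) → Matrix (Fin n) (Fin n) ℝ)
    (x : EuclideanSpace ℝ (Fin m)) (e : Fin m) : Matrix (Fin n) (Fin n) ℝ :=
  Matrix.of fun i j => lineDeriv ℝ (fun y => A y i j) x (EuclideanSpace.single e 1)

/-- The spectraplex `Υ_t`: symmetric positive semidefinite `t × t` matrices of trace one. -/
def spectraplex (t : ℕ) : Set (Matrix (Fin t) (Fin t) ℝ) :=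
  {U | U.PosSemidef ∧ U.trace = 1}

/-- The Clarke subdifferential at `x` of a function `f` that is locally Lipschitz near `x`: the
convex hull of all limits of gradients of `f` along sequences of points of differentiability
tending to `x`. It depends only on the values of `f` near `x`. -/
noncomputable def clarkeSubdifferential {m : ℕ} (f : EuclideanSpace ℝ (Fin m) → ℝ)
    (x : EuclideanSpace ℝ (Fin m)) : Set (EuclideanSpace ℝ (Fin m)) :=
  convexHull ℝ {g | ∃ u : ℕ → EuclideanSpace ℝ (Fin m),
    (∀ i, DifferentiableAt ℝ f (u i)) ∧ Tendsto u atTop (𝓝 x) ∧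
      Tendsto (fun i => gradient f (u i)) atTop (𝓝 g)}

/-!
The largest generalized eigenvalue is the maximum of the generalized Rayleigh quotients
`v ⬝ᵥ A y *ᵥ v / v ⬝ᵥ B y *ᵥ v` over a compact sphere, hence the maximum of a compact family of
`C¹` functions of `y`. For such a maximum `f`, the gradient at a point of differentiability is the
gradient of every active function, so compactness puts every limiting gradient at `x` among the
gradients of the functions active at `x`. Conversely, let `a` be one of the latter gradients. By
Rademacher's theorem `x` can be approached through points of differentiability along any prescribed
direction `d`, and comparing first order expansions at `x` gives a limiting gradient `g` with
`⟪a, d⟫ ≤ ⟪g, d⟫`; by Hahn–Banach the two sets of gradients have the same convex hull. The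
functions active at `x` belong to the eigenvectors `V *ᵥ w` with `w` of length one, and their
gradients are the values of a linear map at the rank-one matrices `w wᵀ`, whose convex hull is the
spectraplex.
-/

open Matrix

section ConvexHull

theorem isCompact_convexHull_of_finiteDimensional {E : Type*} [AddCommGroup E] [Module ℝ E]
    [TopologicalSpace E] [ContinuousAdd E] [ContinuousSMul ℝ E] [FiniteDimensional ℝ E]
    {s : Set E} (hs : IsCompact s) : IsCompact (convexHull ℝ s) := by
  -- Carathéodory: convex combinations of at most `finrank ℝ E + 1` points suffice.
  have caratheodory : convexHull ℝ s = ⋃ k ∈ Finset.range (Module.finrank ℝ E + 2),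
      (fun p : (Fin k → ℝ) × (Fin k → E) => ∑ i, p.1 i • p.2 i) ''
        (stdSimplex ℝ (Fin k) ×ˢ Set.univ.pi fun _ => s) := by
    refine Set.Subset.antisymm (fun y hy => ?_) (Set.iUnion₂_subset ?_)
    · obtain ⟨ι, _, z, w, hz, hind, hw_pos, hw_sum, rfl⟩ :=
        eq_pos_convex_span_of_mem_convexHull hy
      have hcard : Fintype.card ι < Module.finrank ℝ E + 2 := by
        have := Submodule.finrank_le (vectorSpan ℝ (Set.range z))
        have := hind.card_le_finrank_succ
        omega
      let σ := Fintype.equivFin ι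
      exact Set.mem_biUnion (Finset.mem_coe.2 (Finset.mem_range.2 hcard))
        ⟨(w ∘ σ.symm, z ∘ σ.symm), ⟨⟨fun i => (hw_pos _).le, (σ.symm.sum_comp w).trans hw_sum⟩,
          fun i _ => hz ⟨_, rfl⟩⟩, σ.symm.sum_comp fun i => w i • z i⟩
    · rintro k - _ ⟨p, ⟨hp_simplex, hp_mem⟩, rfl⟩
      exact (convex_convexHull ℝ s).sum_mem (fun i _ => hp_simplex.1 i) hp_simplex.2
        fun i _ => subset_convexHull ℝ s (hp_mem i trivial)
  rw [caratheodory]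
  refine Finset.isCompact_biUnion _ fun k _ => ?_
  exact ((isCompact_stdSimplex ℝ (Fin k)).prod (isCompact_univ_pi fun _ => hs)).image
    (by fun_prop)

end ConvexHull

section LimitingGradients

variable {E : Type*} [NormedAddCommGroup E] [InnerProductSpace ℝ E] [CompleteSpace E]

/-- The set of limits of gradients of `f` along points of differentiability tending to `x` (the
B-subdifferential), phrased through the closure of the graph of the gradient so that arbitrary
filters, and not only sequences, can be used to exhibit its elements. -/
def limitingGradients (f : E → ℝ) (x : E) : Set E :=
  {g | (x, g) ∈ closure {p : E × E | DifferentiableAt ℝ f p.1 ∧ gradient f p.1 = p.2}}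

theorem isClosed_limitingGradients (f : E → ℝ) (x : E) : IsClosed (limitingGradients f x) :=
  isClosed_closure.preimage (Continuous.prodMk_right x)

theorem mem_limitingGradients_of_tendsto {ι : Type*} {l : Filter ι} [l.NeBot] {f : E → ℝ}
    {x g : E} {u : ι → E} (hdiff : ∀ᶠ i in l, DifferentiableAt ℝ f (u i))
    (hu : Tendsto u l (𝓝 x)) (hg : Tendsto (fun i => gradient f (u i)) l (𝓝 g)) :
    g ∈ limitingGradients f x :=
  mem_closure_of_tendsto (hu.prodMk_nhds hg) (hdiff.mono fun _ hi => ⟨hi, rfl⟩)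

theorem mem_limitingGradients_iff_exists_seq {f : E → ℝ} {x g : E} :
    g ∈ limitingGradients f x ↔ ∃ u : ℕ → E, (∀ i, DifferentiableAt ℝ f (u i)) ∧
      Tendsto u atTop (𝓝 x) ∧ Tendsto (fun i => gradient f (u i)) atTop (𝓝 g) := by
  refine ⟨fun hg => ?_, fun ⟨u, hdiff, hu, hg⟩ =>
    mem_limitingGradients_of_tendsto (.of_forall hdiff) hu hg⟩
  obtain ⟨p, hp, hlim⟩ := mem_closure_iff_seq_limit.1 hg
  exact ⟨fun i => (p i).1, fun i => (hp i).1, (continuous_fst.tendsto _).comp hlim,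
    ((continuous_snd.tendsto _).comp hlim).congr fun i => (hp i).2.symm⟩

theorem clarkeSubdifferential_eq_convexHull_limitingGradients {m : ℕ}
    (f : EuclideanSpace ℝ (Fin m) → ℝ) (x : EuclideanSpace ℝ (Fin m)) :
    clarkeSubdifferential f x = convexHull ℝ (limitingGradients f x) :=
  congrArg (convexHull ℝ) (Set.ext fun _ => mem_limitingGradients_iff_exists_seq.symm)

end LimitingGradients

section Differentiability

variable {E : Type*} [NormedAddCommGroup E] [NormedSpace ℝ E] [FiniteDimensional ℝ E]

theorem subset_closure_differentiableAt_of_locallyLipschitzOn {f : E → ℝ} {Ω : Set E}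
    (hΩ : IsOpen Ω) (hf : LocallyLipschitzOn Ω f) : Ω ⊆ closure {y | DifferentiableAt ℝ f y} := by
  borelize E
  intro x hx
  obtain ⟨C, s, hs, hlip⟩ := hf hx
  rw [hΩ.nhdsWithin_eq hx] at hs
  have hdense := MeasureTheory.Measure.dense_of_ae
    (hlip.ae_differentiableWithinAt_of_mem (μ := MeasureTheory.Measure.addHaar))
  refine mem_closure_iff.2 fun o ho hxo => ?_
  obtain ⟨y, hy, hyo, hys⟩ := hdense.exists_mem_open (ho.inter isOpen_interior)
    ⟨x, hxo, mem_interior_iff_mem_nhds.2 hs⟩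
  exact ⟨y, hyo, (hy (interior_subset hys)).differentiableAt (mem_interior_iff_mem_nhds.1 hys)⟩

theorem mem_posTangentConeAt_differentiableAt {f : E → ℝ} {Ω : Set E} (hΩ : IsOpen Ω)
    (hf : LocallyLipschitzOn Ω f) {x : E} (hx : x ∈ Ω) (d : E) :
    d ∈ posTangentConeAt {y | DifferentiableAt ℝ f y} x := by
  rw [posTangentConeAt, ← tangentConeAt_closure, tangentConeAt_of_mem_nhds
    (mem_of_superset (hΩ.mem_nhds hx)
      (subset_closure_differentiableAt_of_locallyLipschitzOn hΩ hf))]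
  trivial

end Differentiability

section MaxOfC1Family

variable {E P : Type*} [NormedAddCommGroup E] [InnerProductSpace ℝ E]

/-- The parameters in `K` at which the family `φ` attains the value `f y` at the point `y`. -/
def activeSet (f : E → ℝ) (φ : E → P → ℝ) (K : Set P) (y : E) : Set P :=
  {v | v ∈ K ∧ φ y v = f y}

/-- `f` is on `Ω` the maximum of the functions `φ · v`, `v ∈ K`, where `K` is compact and the
functions and their gradients `G · v` depend jointly continuously on the point and the parameter.
Such functions are called lower-`C¹` in variational analysis. -/
structure IsMaxOfC1Family [CompleteSpace E] [TopologicalSpace P] (f : E → ℝ) (φ : E → P → ℝ)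
    (G : E → P → E) (Ω : Set E) (K : Set P) : Prop where
  isOpen : IsOpen Ω
  isCompact : IsCompact K
  hasGradientAt : ∀ y ∈ Ω, ∀ v ∈ K, HasGradientAt (fun z => φ z v) (G y v) y
  continuousOn_value : ContinuousOn (fun p : E × P => φ p.1 p.2) (Ω ×ˢ K)
  continuousOn_gradient : ContinuousOn (fun p : E × P => G p.1 p.2) (Ω ×ˢ K)
  le : ∀ y ∈ Ω, ∀ v ∈ K, φ y v ≤ f y
  exists_mem_activeSet : ∀ y ∈ Ω, ∃ v, v ∈ activeSet f φ K y

namespace IsMaxOfC1Family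

variable [TopologicalSpace P] {f : E → ℝ} {φ : E → P → ℝ} {G : E → P → E} {Ω : Set E}
  {K : Set P} {x : E}

section CompleteSpace

variable [CompleteSpace E]

theorem eventually_norm_gradient_sub_le (h : IsMaxOfC1Family f φ G Ω K) (hx : x ∈ Ω) {ε : ℝ}
    (hε : 0 < ε) : ∀ᶠ u in 𝓝 x, ∀ v ∈ K, ‖G u v - G x v‖ ≤ ε := by
  obtain ⟨s, hs, hunif⟩ := h.isCompact.mem_uniformity_of_prod h.continuousOn_gradient hx
    (Metric.dist_mem_uniformity hε)
  rw [h.isOpen.nhdsWithin_eq hx] at hs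
  filter_upwards [hs] with u hu v hv
  exact (dist_eq_norm (G u v) (G x v)).symm.trans_le (hunif u hu v hv).le

theorem eventually_abs_sub_sub_inner_le (h : IsMaxOfC1Family f φ G Ω K) (hx : x ∈ Ω) {ε : ℝ}
    (hε : 0 < ε) : ∀ᶠ u in 𝓝 x, ∀ v ∈ K,
      |φ u v - φ x v - inner ℝ (G x v) (u - x)| ≤ ε * ‖u - x‖ := by
  obtain ⟨r, hr, hball⟩ := Metric.eventually_nhds_iff_ball.1
    ((h.eventually_norm_gradient_sub_le hx hε).and (h.isOpen.eventually_mem hx))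
  filter_upwards [Metric.ball_mem_nhds x hr] with u hu v hv
  have hderiv : ∀ z ∈ Metric.ball x r, HasFDerivWithinAt (fun z => φ z v)
      (InnerProductSpace.toDual ℝ E (G z v)) (Metric.ball x r) z := fun z hz =>
    (h.hasGradientAt z (hball z hz).2 v hv).hasFDerivAt.hasFDerivWithinAt
  have hbound : ∀ z ∈ Metric.ball x r,
      ‖InnerProductSpace.toDual ℝ E (G z v) - InnerProductSpace.toDual ℝ E (G x v)‖ ≤ ε := by
    intro z hz
    rw [← map_sub, LinearIsometryEquiv.norm_map]
    exact (hball z hz).1 v hv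
  exact (convex_ball x r).norm_image_sub_le_of_norm_hasFDerivWithin_le' hderiv hbound
    (Metric.mem_ball_self hr) hu

theorem exists_eventually_norm_gradient_le (h : IsMaxOfC1Family f φ G Ω K) (hx : x ∈ Ω) :
    ∃ C, ∀ᶠ u in 𝓝 x, ∀ v ∈ K, ‖G u v‖ ≤ C := by
  obtain ⟨C, hC⟩ := h.isCompact.exists_bound_of_continuousOn
    (h.continuousOn_gradient.comp (Continuous.prodMk_right x).continuousOn
      fun _ hv => Set.mk_mem_prod hx hv)
  refine ⟨C + 1, (h.eventually_norm_gradient_sub_le hx one_pos).mono fun u hu v hv => ?_⟩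
  exact (norm_le_norm_add_norm_sub' _ _).trans (add_le_add (hC v hv) (hu v hv))

theorem locallyLipschitzOn (h : IsMaxOfC1Family f φ G Ω K) : LocallyLipschitzOn Ω f := by
  intro x hx
  obtain ⟨C, hC⟩ := h.exists_eventually_norm_gradient_le hx
  obtain ⟨r, hr, hball⟩ := Metric.eventually_nhds_iff_ball.1 (hC.and (h.isOpen.eventually_mem hx))
  refine ⟨C.toNNReal, Metric.ball x r, mem_nhdsWithin_of_mem_nhds (Metric.ball_mem_nhds x hr),
    LipschitzOnWith.of_le_add_mul' C fun y hy z hz => ?_⟩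
  obtain ⟨v, hv, hvy⟩ := h.exists_mem_activeSet y (hball y hy).2
  have hlip : ‖φ y v - φ z v‖ ≤ C * ‖y - z‖ :=
    (convex_ball x r).norm_image_sub_le_of_norm_hasFDerivWithin_le
      (fun w hw => (h.hasGradientAt w (hball w hw).2 v hv).hasFDerivAt.hasFDerivWithinAt)
      (fun w hw => (LinearIsometryEquiv.norm_map _ _).trans_le ((hball w hw).1 v hv)) hz hy
  calc f y = φ z v + (φ y v - φ z v) := by rw [← hvy]; ring
    _ ≤ f z + C * dist y z := by
      rw [dist_eq_norm]
      exact add_le_add (h.le z (hball z hz).2 v hv) ((Real.le_norm_self _).trans hlip)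

theorem gradient_eq_of_mem_activeSet (h : IsMaxOfC1Family f φ G Ω K) (hx : x ∈ Ω) {v : P}
    (hv : v ∈ activeSet f φ K x) (hf : DifferentiableAt ℝ f x) : gradient f x = G x v := by
  have hmin : IsLocalMin (fun z => f z - φ z v) x := by
    filter_upwards [h.isOpen.eventually_mem hx] with z hz
    rw [hv.2, sub_self]
    exact sub_nonneg.2 (h.le z hz v hv.1)
  have hzero := hmin.hasFDerivAt_eq_zero
    (hf.hasGradientAt.hasFDerivAt.sub (h.hasGradientAt x hx v hv.1).hasFDerivAt)
  exact (InnerProductSpace.toDual ℝ E).injective (sub_eq_zero.1 hzero)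

theorem exists_tendsto_gradient_of_mem_activeSet (h : IsMaxOfC1Family f φ G Ω K) (hx : x ∈ Ω)
    {ι : Type*} {l : Filter ι} [l.NeBot] {u : ι → E} {w : ι → P} (hu : Tendsto u l (𝓝 x))
    (hw : ∀ᶠ i in l, w i ∈ activeSet f φ K (u i)) :
    ∃ l' ≤ l, l'.NeBot ∧ ∃ v ∈ activeSet f φ K x,
      Tendsto (fun i => G (u i) (w i)) l' (𝓝 (G x v)) := by
  have hle : (Ultrafilter.of l : Filter ι) ≤ l := Ultrafilter.of_le l
  obtain ⟨v, hv, hwv⟩ := h.isCompact.ultrafilter_le_nhds' ((Ultrafilter.of l).map w)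
    (hle (hw.mono fun _ hi => hi.1))
  have huw : Tendsto (fun i => (u i, w i)) (Ultrafilter.of l) (𝓝[Ω ×ˢ K] (x, v)) :=
    tendsto_nhdsWithin_iff.2 ⟨(hu.mono_left hle).prodMk_nhds hwv,
      hle (((hu.eventually (h.isOpen.eventually_mem hx)).and hw).mono fun _ hi => ⟨hi.1, hi.2.1⟩)⟩
  have hactive : φ x v = f x := tendsto_nhds_unique_of_eventuallyEq
    ((h.continuousOn_value (x, v) ⟨hx, hv⟩).tendsto.comp huw)
    ((h.locallyLipschitzOn.continuousOn.continuousAt (h.isOpen.mem_nhds hx)).tendsto.comp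
      (hu.mono_left hle)) (hle (hw.mono fun _ hi => hi.2))
  exact ⟨Ultrafilter.of l, hle, inferInstance, v, ⟨hv, hactive⟩,
    (h.continuousOn_gradient (x, v) ⟨hx, hv⟩).tendsto.comp huw⟩

theorem limitingGradients_subset (h : IsMaxOfC1Family f φ G Ω K) (hx : x ∈ Ω) :
    limitingGradients f x ⊆ G x '' activeSet f φ K x := by
  intro g hg
  obtain ⟨u, hdiff, hu, hug⟩ := mem_limitingGradients_iff_exists_seq.1 hg
  have huΩ : ∀ᶠ i in atTop, u i ∈ Ω := hu.eventually (h.isOpen.eventually_mem hx)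
  obtain ⟨w, hw⟩ := (huΩ.mono fun i hi => h.exists_mem_activeSet (u i) hi).choice
  obtain ⟨l', hl', _, v, hv, hlim⟩ := h.exists_tendsto_gradient_of_mem_activeSet hx hu hw
  have hgrad : ∀ᶠ i in atTop, gradient f (u i) = G (u i) (w i) :=
    (huΩ.and hw).mono fun i hi => h.gradient_eq_of_mem_activeSet hi.1 hi.2 (hdiff i)
  exact ⟨v, hv, tendsto_nhds_unique_of_eventuallyEq hlim (hug.mono_left hl')
    (hl' (hgrad.mono fun _ hi => hi.symm))⟩

/-- This is Spingarn's submonotonicity of the subdifferential of a lower-`C¹` function. -/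
theorem eventually_inner_sub_le_inner (h : IsMaxOfC1Family f φ G Ω K) (hx : x ∈ Ω) {ε : ℝ}
    (hε : 0 < ε) : ∀ᶠ u in 𝓝 x, ∀ w ∈ activeSet f φ K u, ∀ v ∈ activeSet f φ K x,
      inner ℝ (G x v) (u - x) - ε * ‖u - x‖ ≤ inner ℝ (G u w) (u - x) := by
  have hε3 : 0 < ε / 3 := by positivity
  filter_upwards [h.eventually_abs_sub_sub_inner_le hx hε3,
    h.eventually_norm_gradient_sub_le hx hε3, h.isOpen.eventually_mem hx]
    with u htaylor hgrad huΩ w hw v hv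
  have hv_taylor := (abs_le.1 (htaylor v hv.1)).1
  have hw_taylor := (abs_le.1 (htaylor w hw.1)).2
  have hv_le := h.le u huΩ v hv.1
  have hw_le := h.le x hx w hw.1
  have hgrad_inner : inner ℝ (G x w) (u - x) - inner ℝ (G u w) (u - x) ≤ ε / 3 * ‖u - x‖ := by
    rw [← inner_sub_left]
    refine (real_inner_le_norm _ _).trans ?_
    rw [norm_sub_rev]
    exact mul_le_mul_of_nonneg_right (hgrad w hw.1) (norm_nonneg _)
  linarith [hv.2, hw.2]

theorem inner_le_inner_of_tendsto (h : IsMaxOfC1Family f φ G Ω K) (hx : x ∈ Ω) {ι : Type*}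
    {l : Filter ι} [l.NeBot] {c : ι → NNReal} {δ : ι → E} {w : ι → P} {v : P} {d g : E}
    (hu : Tendsto (fun i => x + δ i) l (𝓝 x)) (hd : Tendsto (fun i => c i • δ i) l (𝓝 d))
    (hw : ∀ᶠ i in l, w i ∈ activeSet f φ K (x + δ i)) (hv : v ∈ activeSet f φ K x)
    (hg : Tendsto (fun i => G (x + δ i) (w i)) l (𝓝 g)) : inner ℝ (G x v) d ≤ inner ℝ g d := by
  have happrox : ∀ ε > 0, inner ℝ (G x v) d - ε * ‖d‖ ≤ inner ℝ g d := by
    intro ε hε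
    refine le_of_tendsto_of_tendsto
      ((tendsto_const_nhds.inner hd).sub (hd.norm.const_mul ε)) (hg.inner hd) ?_
    filter_upwards [hu.eventually (h.eventually_inner_sub_le_inner hx hε), hw] with i hi hwi
    have hscaled := mul_le_mul_of_nonneg_left (hi (w i) hwi v hv) (c i).coe_nonneg
    rw [add_sub_cancel_left] at hscaled
    simp only [NNReal.smul_def, inner_smul_right, norm_smul, NNReal.norm_eq]
    linarith
  have hε_zero : Tendsto (fun ε => inner ℝ (G x v) d - ε * ‖d‖) (𝓝[>] 0)
      (𝓝 (inner ℝ (G x v) d - 0 * ‖d‖)) :=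
    (Continuous.tendsto (by fun_prop) 0).mono_left nhdsWithin_le_nhds
  rw [zero_mul, sub_zero] at hε_zero
  exact le_of_tendsto hε_zero (eventually_mem_nhdsWithin.mono happrox)

end CompleteSpace

section FiniteDimensional

variable [FiniteDimensional ℝ E]

theorem isCompact_limitingGradients (h : IsMaxOfC1Family f φ G Ω K) (hx : x ∈ Ω) :
    IsCompact (limitingGradients f x) := by
  obtain ⟨C, hC⟩ := h.exists_eventually_norm_gradient_le hx
  refine Metric.isCompact_of_isClosed_isBounded (isClosed_limitingGradients f x)
    ((Metric.isBounded_closedBall (x := 0) (r := C)).subset fun g hg => ?_)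
  obtain ⟨v, hv, rfl⟩ := h.limitingGradients_subset hx hg
  exact mem_closedBall_zero_iff.2 (hC.self_of_nhds v hv.1)

theorem exists_limitingGradients_inner_le (h : IsMaxOfC1Family f φ G Ω K) (hx : x ∈ Ω) {v : P}
    (hv : v ∈ activeSet f φ K x) (d : E) :
    ∃ g ∈ limitingGradients f x, inner ℝ (G x v) d ≤ inner ℝ g d := by
  obtain ⟨ι, l, _, c, δ, hδ, hdiff, hcδ⟩ := exists_fun_of_mem_tangentConeAt
    (mem_posTangentConeAt_differentiableAt h.isOpen h.locallyLipschitzOn hx d)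
  have hu : Tendsto (fun i => x + δ i) l (𝓝 x) := by simpa using hδ.const_add x
  have huΩ : ∀ᶠ i in l, x + δ i ∈ Ω := hu.eventually (h.isOpen.eventually_mem hx)
  obtain ⟨w, hw⟩ := (huΩ.mono fun i hi => h.exists_mem_activeSet (x + δ i) hi).choice
  obtain ⟨l', hl', _, v', -, hlim⟩ := h.exists_tendsto_gradient_of_mem_activeSet hx hu hw
  have hgrad : ∀ᶠ i in l', G (x + δ i) (w i) = gradient f (x + δ i) := hl' <| by
    filter_upwards [huΩ, hw, hdiff] with i hi hwi hdi
    exact (h.gradient_eq_of_mem_activeSet hi hwi hdi).symm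
  exact ⟨G x v', mem_limitingGradients_of_tendsto (hl' hdiff) (hu.mono_left hl')
    (hlim.congr' hgrad), h.inner_le_inner_of_tendsto hx (hu.mono_left hl') (hcδ.mono_left hl')
    (hl' hw) hv hlim⟩

theorem convexHull_limitingGradients (h : IsMaxOfC1Family f φ G Ω K) (hx : x ∈ Ω) :
    convexHull ℝ (limitingGradients f x) = convexHull ℝ (G x '' activeSet f φ K x) := by
  refine (convexHull_mono (h.limitingGradients_subset hx)).antisymm
    (convexHull_min ?_ (convex_convexHull ℝ _))
  rintro _ ⟨v, hv, rfl⟩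
  by_contra hnot
  have hclosed : IsClosed (convexHull ℝ (limitingGradients f x)) :=
    (isCompact_convexHull_of_finiteDimensional (h.isCompact_limitingGradients hx)).isClosed
  obtain ⟨s, r, hlt, hgt⟩ :=
    geometric_hahn_banach_closed_point (convex_convexHull ℝ _) hclosed hnot
  obtain ⟨g, hg, hle⟩ := h.exists_limitingGradients_inner_le hx hv
    ((InnerProductSpace.toDual ℝ E).symm s)
  rw [real_inner_comm, InnerProductSpace.toDual_symm_apply, real_inner_comm,
    InnerProductSpace.toDual_symm_apply] at hle
  exact (hgt.trans_le hle).not_gt (hlt g (subset_convexHull ℝ _ hg))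

end FiniteDimensional

end IsMaxOfC1Family

end MaxOfC1Family

section Spectraplex

theorem convex_spectraplex (t : ℕ) : Convex ℝ (spectraplex t) := by
  rintro U ⟨hU, hU_trace⟩ W ⟨hW, hW_trace⟩ a b ha hb hab
  refine ⟨(hU.smul ha).add (hW.smul hb), ?_⟩
  rw [trace_add, trace_smul, trace_smul, hU_trace, hW_trace, ← add_smul, hab, one_smul]

theorem exists_dotProduct_self_eq_one_and_smul_eq {ι : Type*} [Fintype ι] [Nonempty ι]
    (v : ι → ℝ) : ∃ w : ι → ℝ, w ⬝ᵥ w = 1 ∧ ∃ c : ℝ, c • w = v := by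
  classical
  rcases eq_or_ne v 0 with rfl | hv
  · obtain ⟨i⟩ := ‹Nonempty ι›
    exact ⟨Pi.single i 1, by simp, 0, zero_smul _ _⟩
  · have hpos : 0 < v ⬝ᵥ v := by simpa using dotProduct_star_self_pos_iff.2 hv
    have hsqrt : √(v ⬝ᵥ v) ≠ 0 := (Real.sqrt_pos.2 hpos).ne'
    refine ⟨(√(v ⬝ᵥ v))⁻¹ • v, ?_, √(v ⬝ᵥ v), smul_inv_smul₀ hsqrt v⟩
    rw [smul_dotProduct, dotProduct_smul, smul_smul, ← mul_inv, Real.mul_self_sqrt hpos.le,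
      smul_eq_mul, inv_mul_cancel₀ hpos.ne']

theorem spectraplex_eq_convexHull (t : ℕ) :
    spectraplex t = convexHull ℝ ((fun w : Fin t → ℝ => vecMulVec w w) '' {w | w ⬝ᵥ w = 1}) := by
  refine Set.Subset.antisymm ?_ (convexHull_min ?_ (convex_spectraplex t))
  · rintro U ⟨hU, hU_trace⟩
    have : Nonempty (Fin t) := by
      by_contra hempty
      rw [not_nonempty_iff] at hempty
      simp [trace] at hU_trace
    obtain ⟨k, v, hv⟩ := posSemidef_iff_eq_sum_vecMulVec.1 hU
    choose w hw c hc using fun i => exists_dotProduct_self_eq_one_and_smul_eq (v i)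
    have hsum : U = ∑ i, (c i * c i) • vecMulVec (w i) (w i) := by
      simp only [hv, star_trivial, ← hc, smul_vecMulVec, vecMulVec_smul, smul_smul]
    have hweights : ∑ i, c i * c i = 1 := by
      simpa [hsum, trace_sum, trace_smul, trace_vecMulVec, hw] using hU_trace
    rw [hsum]
    exact (convex_convexHull ℝ _).sum_mem (fun i _ => mul_self_nonneg (c i)) hweights
      fun i _ => subset_convexHull ℝ _ ⟨w i, hw i, rfl⟩
  · rintro _ ⟨w, hw, rfl⟩
    exact ⟨by simpa using posSemidef_vecMulVec_self_star w, (trace_vecMulVec w w).trans hw⟩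

end Spectraplex

section RayleighQuotient

variable {ι : Type*} [Fintype ι]

/-- The generalized Rayleigh quotient of the pair `(X, Y)` at the vector `v`, with the junk value
`0` where the quadratic form of `Y` vanishes. -/
noncomputable def genRayleigh (X Y : Matrix ι ι ℝ) (v : ι → ℝ) : ℝ :=
  (v ⬝ᵥ X *ᵥ v) / (v ⬝ᵥ Y *ᵥ v)

theorem dotProduct_mulVec_pos_of_posDef {Y : Matrix ι ι ℝ} (hY : Y.PosDef) {v : ι → ℝ}
    (hv : v ≠ 0) : 0 < v ⬝ᵥ Y *ᵥ v := by
  simpa only [star_trivial] using hY.dotProduct_mulVec_pos hv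

theorem genRayleigh_smul (X Y : Matrix ι ι ℝ) {c : ℝ} (hc : c ≠ 0) (v : ι → ℝ) :
    genRayleigh X Y (c • v) = genRayleigh X Y v := by
  simp only [genRayleigh, mulVec_smul, dotProduct_smul, smul_dotProduct, smul_eq_mul]
  rw [mul_div_mul_left _ _ hc, mul_div_mul_left _ _ hc]

theorem genRayleigh_of_eigenvector {X Y : Matrix ι ι ℝ} (hY : Y.PosDef) {v : ι → ℝ} (hv : v ≠ 0)
    {μ : ℝ} (h : X *ᵥ v = μ • Y *ᵥ v) : genRayleigh X Y v = μ := by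
  rw [genRayleigh, h, dotProduct_smul, smul_eq_mul,
    mul_div_cancel_right₀ _ (dotProduct_mulVec_pos_of_posDef hY hv).ne']

theorem eigenvector_of_forall_genRayleigh_le {X Y : Matrix ι ι ℝ} (hX : X.IsSymm)
    (hY : Y.PosDef) {v : ι → ℝ} (hv : v ≠ 0)
    (hmax : ∀ w, w ≠ 0 → genRayleigh X Y w ≤ genRayleigh X Y v) :
    X *ᵥ v = genRayleigh X Y v • Y *ᵥ v := by
  set μ := genRayleigh X Y v with hμ
  have hform : ∀ w : ι → ℝ,
      star w ⬝ᵥ (μ • Y - X) *ᵥ w = μ * (w ⬝ᵥ Y *ᵥ w) - w ⬝ᵥ X *ᵥ w := fun w => by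
    rw [star_trivial, sub_mulVec, smul_mulVec, dotProduct_sub, dotProduct_smul, smul_eq_mul]
  have hpsd : (μ • Y - X).PosSemidef := by
    refine .of_dotProduct_mulVec_nonneg ?_ fun w => ?_
    · rw [isHermitian_iff_isSymm]
      exact ((isHermitian_iff_isSymm.1 hY.isHermitian).smul μ).sub hX
    · rw [hform, sub_nonneg]
      rcases eq_or_ne w 0 with rfl | hw
      · simp
      · exact (div_le_iff₀ (dotProduct_mulVec_pos_of_posDef hY hw)).1 (hmax w hw)
  have hker : (μ • Y - X) *ᵥ v = 0 := by
    rw [← hpsd.dotProduct_mulVec_zero_iff, hform, hμ, genRayleigh,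
      div_mul_cancel₀ _ (dotProduct_mulVec_pos_of_posDef hY hv).ne', sub_self]
  rw [sub_mulVec, smul_mulVec, sub_eq_zero] at hker
  exact hker.symm

theorem continuousOn_genRayleigh {α : Type*} [TopologicalSpace α] {s : Set α}
    {X Y : α → Matrix ι ι ℝ} {v : α → ι → ℝ} (hX : ContinuousOn X s) (hY : ContinuousOn Y s)
    (hv : ContinuousOn v s) (hpos : ∀ p ∈ s, (Y p).PosDef) (hv_ne : ∀ p ∈ s, v p ≠ 0) :
    ContinuousOn (fun p => genRayleigh (X p) (Y p) (v p)) s := by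
  have hform : Continuous fun q : (ι → ℝ) × Matrix ι ι ℝ => q.1 ⬝ᵥ q.2 *ᵥ q.1 := by fun_prop
  exact (hform.comp_continuousOn (hv.prodMk hX)).div (hform.comp_continuousOn (hv.prodMk hY))
    fun p hp => (dotProduct_mulVec_pos_of_posDef (hpos p hp) (hv_ne p hp)).ne'

theorem exists_forall_genRayleigh_le [Nonempty ι] (X : Matrix ι ι ℝ) {Y : Matrix ι ι ℝ}
    (hY : Y.PosDef) : ∃ v, v ≠ 0 ∧ ∀ w, w ≠ 0 → genRayleigh X Y w ≤ genRayleigh X Y v := by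
  have hsphere_ne : ∀ v ∈ Metric.sphere (0 : ι → ℝ) 1, v ≠ 0 := fun v hv =>
    ne_zero_of_mem_unit_sphere ⟨v, hv⟩
  obtain ⟨v, hv, hmax⟩ := (isCompact_sphere (0 : ι → ℝ) 1).exists_isMaxOn
    (NormedSpace.sphere_nonempty.2 zero_le_one)
    (continuousOn_genRayleigh (X := fun _ => X) continuousOn_const continuousOn_const
      continuousOn_id (fun _ _ => hY) hsphere_ne)
  refine ⟨v, hsphere_ne v hv, fun w hw => ?_⟩
  rw [← genRayleigh_smul X Y (inv_ne_zero (norm_ne_zero_iff.2 hw)) w]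
  exact hmax (by simp [norm_smul, hw])

end RayleighQuotient

section MaxGenEigenvalue

variable {n : ℕ} {X Y : Matrix (Fin n) (Fin n) ℝ}

theorem isGreatest_genRayleigh_image_maxGenEigenvalue (hn : 0 < n) (hX : X.IsSymm)
    (hY : Y.PosDef) : IsGreatest (genRayleigh X Y '' {0}ᶜ) (maxGenEigenvalue X Y) := by
  have : Nonempty (Fin n) := ⟨⟨0, hn⟩⟩
  obtain ⟨v, hv, hmax⟩ := exists_forall_genRayleigh_le X hY
  have hgreatest : IsGreatest {μ | IsGenEigenvalue X Y μ} (genRayleigh X Y v) := by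
    refine ⟨⟨v, hv, eigenvector_of_forall_genRayleigh_le hX hY hv hmax⟩, ?_⟩
    rintro μ ⟨w, hw, hwμ⟩
    exact (genRayleigh_of_eigenvector hY hw hwμ).ge.trans (hmax w hw)
  rw [maxGenEigenvalue, hgreatest.csSup_eq]
  exact ⟨⟨v, hv, rfl⟩, Set.forall_mem_image.2 hmax⟩

theorem genRayleigh_eq_maxGenEigenvalue_iff (hn : 0 < n) (hX : X.IsSymm) (hY : Y.PosDef)
    {v : Fin n → ℝ} (hv : v ≠ 0) : genRayleigh X Y v = maxGenEigenvalue X Y ↔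
      X *ᵥ v = maxGenEigenvalue X Y • Y *ᵥ v := by
  refine ⟨fun h => ?_, genRayleigh_of_eigenvector hY hv⟩
  rw [← h]
  refine eigenvector_of_forall_genRayleigh_le hX hY hv fun w hw => ?_
  rw [h]
  exact (isGreatest_genRayleigh_image_maxGenEigenvalue hn hX hY).2 ⟨w, hw, rfl⟩

end MaxGenEigenvalue

section RayleighDerivative

theorem hasDerivAt_dotProduct_mulVec {ι : Type*} [Fintype ι] {X : ℝ → Matrix ι ι ℝ}
    {X' : Matrix ι ι ℝ} {s : ℝ} (hX : ∀ i j, HasDerivAt (fun r => X r i j) (X' i j) s)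
    (v : ι → ℝ) : HasDerivAt (fun r => v ⬝ᵥ X r *ᵥ v) (v ⬝ᵥ X' *ᵥ v) s :=
  HasDerivAt.fun_sum fun i _ =>
    (HasDerivAt.fun_sum fun j _ => (hX i j).mul_const (v j)).const_mul (v i)

theorem hasDerivAt_genRayleigh {ι : Type*} [Fintype ι] {X Y : ℝ → Matrix ι ι ℝ}
    {X' Y' : Matrix ι ι ℝ} {s : ℝ} (hX : ∀ i j, HasDerivAt (fun r => X r i j) (X' i j) s)
    (hY : ∀ i j, HasDerivAt (fun r => Y r i j) (Y' i j) s) {v : ι → ℝ}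
    (hv : v ⬝ᵥ Y s *ᵥ v ≠ 0) : HasDerivAt (fun r => genRayleigh (X r) (Y r) v)
      (genRayleigh (X' - genRayleigh (X s) (Y s) v • Y') (Y s) v) s := by
  refine ((hasDerivAt_dotProduct_mulVec hX v).fun_div
    (hasDerivAt_dotProduct_mulVec hY v) hv).congr_deriv ?_
  simp only [genRayleigh, sub_mulVec, smul_mulVec, dotProduct_sub, dotProduct_smul, smul_eq_mul]
  field_simp

theorem hasGradientAt_toLp_of_hasLineDerivAt {m : ℕ} {f : EuclideanSpace ℝ (Fin m) → ℝ}
    {x : EuclideanSpace ℝ (Fin m)} {g : Fin m → ℝ} (hf : DifferentiableAt ℝ f x)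
    (hg : ∀ e, HasLineDerivAt ℝ f (g e) x (EuclideanSpace.single e 1)) :
    HasGradientAt f (WithLp.toLp 2 g) x := by
  have hgrad : gradient f x = WithLp.toLp 2 g := by
    ext e
    change gradient f x e = g e
    rw [← (hg e).lineDeriv, hf.lineDeriv_eq_fderiv, ← inner_gradient_left,
      EuclideanSpace.inner_single_right]
    simp
  exact hgrad ▸ hf.hasGradientAt

variable {m n : ℕ} {A B : EuclideanSpace ℝ (Fin m) → Matrix (Fin n) (Fin n) ℝ}
  {Ω : Set (EuclideanSpace ℝ (Fin m))} {y : EuclideanSpace ℝ (Fin m)}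

namespace MatrixC1On

theorem continuousOn (hA : MatrixC1On A Ω) : ContinuousOn A Ω :=
  continuousOn_pi.2 fun i => continuousOn_pi.2 fun j => (hA i j).continuousOn

theorem differentiableAt (hA : MatrixC1On A Ω) (hΩ : IsOpen Ω) (hy : y ∈ Ω) (i j : Fin n) :
    DifferentiableAt ℝ (fun z => A z i j) y :=
  ((hA i j).differentiableOn one_ne_zero).differentiableAt (hΩ.mem_nhds hy)

theorem continuousOn_matrixPartialDeriv (hA : MatrixC1On A Ω) (hΩ : IsOpen Ω) (e : Fin m) :
    ContinuousOn (fun z => matrixPartialDeriv A z e) Ω :=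
  continuousOn_pi.2 fun i => continuousOn_pi.2 fun j =>
    (((hA i j).continuousOn_fderiv_of_isOpen hΩ le_rfl).clm_apply continuousOn_const).congr
      fun _ hz => (hA.differentiableAt hΩ hz i j).lineDeriv_eq_fderiv

end MatrixC1On

/-- The gradient at `y` of the Rayleigh quotient `z ↦ genRayleigh (A z) (B z) v`. Its components
are written as Rayleigh quotients, which makes it invariant under scaling of `v`. -/
noncomputable def genRayleighGradient (A B : EuclideanSpace ℝ (Fin m) → Matrix (Fin n) (Fin n) ℝ)
    (y : EuclideanSpace ℝ (Fin m)) (v : Fin n → ℝ) : EuclideanSpace ℝ (Fin m) :=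
  WithLp.toLp 2 fun e => genRayleigh
    (matrixPartialDeriv A y e - genRayleigh (A y) (B y) v • matrixPartialDeriv B y e) (B y) v

theorem genRayleighGradient_smul {c : ℝ} (hc : c ≠ 0) (v : Fin n → ℝ) :
    genRayleighGradient A B y (c • v) = genRayleighGradient A B y v := by
  simp only [genRayleighGradient, genRayleigh_smul _ _ hc]

theorem hasGradientAt_genRayleigh (hA : ∀ i j, DifferentiableAt ℝ (fun z => A z i j) y)
    (hB : ∀ i j, DifferentiableAt ℝ (fun z => B z i j) y) {v : Fin n → ℝ}
    (hv : v ⬝ᵥ B y *ᵥ v ≠ 0) :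
    HasGradientAt (fun z => genRayleigh (A z) (B z) v) (genRayleighGradient A B y v) y := by
  refine hasGradientAt_toLp_of_hasLineDerivAt ?_ fun e => ?_
  · have hform : ∀ C : EuclideanSpace ℝ (Fin m) → Matrix (Fin n) (Fin n) ℝ,
        (∀ i j, DifferentiableAt ℝ (fun z => C z i j) y) →
        DifferentiableAt ℝ (fun z => v ⬝ᵥ C z *ᵥ v) y := fun C hC => by
      simp only [dotProduct, mulVec]
      fun_prop
    simp only [genRayleigh, div_eq_mul_inv]
    exact (hform A hA).fun_mul ((hform B hB).fun_inv hv)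
  · have hline : ∀ C : EuclideanSpace ℝ (Fin m) → Matrix (Fin n) (Fin n) ℝ,
        (∀ i j, DifferentiableAt ℝ (fun z => C z i j) y) → ∀ i j,
        HasDerivAt (fun r : ℝ => C (y + r • EuclideanSpace.single e 1) i j)
          (matrixPartialDeriv C y e i j) 0 := fun C hC i j =>
      (hC i j).lineDifferentiableAt.hasLineDerivAt
    have hderiv := hasDerivAt_genRayleigh (hline A hA) (hline B hB) (v := v) (by simpa using hv)
    simpa only [HasLineDerivAt, zero_smul, add_zero] using hderiv

theorem continuousOn_genRayleigh_prod {K : Set (Fin n → ℝ)} (hA : ContinuousOn A Ω)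
    (hB : ContinuousOn B Ω) (hBpos : ∀ y ∈ Ω, (B y).PosDef) (hK : ∀ v ∈ K, v ≠ 0) :
    ContinuousOn (fun p : EuclideanSpace ℝ (Fin m) × (Fin n → ℝ) =>
      genRayleigh (A p.1) (B p.1) p.2) (Ω ×ˢ K) :=
  continuousOn_genRayleigh (hA.comp continuousOn_fst fun _ hp => hp.1)
    (hB.comp continuousOn_fst fun _ hp => hp.1) continuousOn_snd (fun p hp => hBpos p.1 hp.1)
    fun p hp => hK p.2 hp.2

theorem continuousOn_genRayleighGradient {K : Set (Fin n → ℝ)} (hΩ : IsOpen Ω)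
    (hA : MatrixC1On A Ω) (hB : MatrixC1On B Ω) (hBpos : ∀ y ∈ Ω, (B y).PosDef)
    (hK : ∀ v ∈ K, v ≠ 0) : ContinuousOn (fun p : EuclideanSpace ℝ (Fin m) × (Fin n → ℝ) =>
      genRayleighGradient A B p.1 p.2) (Ω ×ˢ K) := by
  have hfst : ∀ {C : EuclideanSpace ℝ (Fin m) → Matrix (Fin n) (Fin n) ℝ}, ContinuousOn C Ω →
      ContinuousOn (fun p : EuclideanSpace ℝ (Fin m) × (Fin n → ℝ) => C p.1) (Ω ×ˢ K) :=
    fun hC => hC.comp continuousOn_fst fun _ hp => hp.1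
  have hvalue := continuousOn_genRayleigh_prod hA.continuousOn hB.continuousOn hBpos hK
  exact (PiLp.continuous_toLp 2 _).comp_continuousOn <| continuousOn_pi.2 fun e =>
    continuousOn_genRayleigh
      ((hfst (hA.continuousOn_matrixPartialDeriv hΩ e)).sub
        (hvalue.smul (hfst (hB.continuousOn_matrixPartialDeriv hΩ e))))
      (hfst hB.continuousOn) continuousOn_snd (fun p hp => hBpos p.1 hp.1)
      fun p hp => hK p.2 hp.2

theorem isMaxOfC1Family_maxGenEigenvalueFun (hn : 0 < n) (hΩ : IsOpen Ω) (hA : MatrixC1On A Ω)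
    (hB : MatrixC1On B Ω) (hAsymm : ∀ y ∈ Ω, (A y).IsSymm) (hBpos : ∀ y ∈ Ω, (B y).PosDef) :
    IsMaxOfC1Family (maxGenEigenvalueFun A B) (fun y => genRayleigh (A y) (B y))
      (genRayleighGradient A B) Ω (Metric.sphere 0 1) := by
  have hsphere_ne : ∀ v ∈ Metric.sphere (0 : Fin n → ℝ) 1, v ≠ 0 := fun v hv =>
    ne_zero_of_mem_unit_sphere ⟨v, hv⟩
  refine ⟨hΩ, isCompact_sphere 0 1, fun y hy v hv => ?_,
    continuousOn_genRayleigh_prod hA.continuousOn hB.continuousOn hBpos hsphere_ne,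
    continuousOn_genRayleighGradient hΩ hA hB hBpos hsphere_ne, fun y hy v hv => ?_,
    fun y hy => ?_⟩
  · exact hasGradientAt_genRayleigh (hA.differentiableAt hΩ hy) (hB.differentiableAt hΩ hy)
      (dotProduct_mulVec_pos_of_posDef (hBpos y hy) (hsphere_ne v hv)).ne'
  · exact (isGreatest_genRayleigh_image_maxGenEigenvalue hn (hAsymm y hy) (hBpos y hy)).2
      ⟨v, hsphere_ne v hv, rfl⟩
  · obtain ⟨v, hv : v ≠ 0, hv_max⟩ :=
      (isGreatest_genRayleigh_image_maxGenEigenvalue hn (hAsymm y hy) (hBpos y hy)).1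
    refine ⟨‖v‖⁻¹ • v, by simp [norm_smul, hv], ?_⟩
    exact (genRayleigh_smul _ _ (inv_ne_zero (norm_ne_zero_iff.2 hv)) v).trans hv_max

end RayleighDerivative

section Eigenspace

theorem trace_vecMulVec_self_mul_compression {ι κ : Type*} [Fintype ι] [Fintype κ]
    (V : Matrix ι κ ℝ) (M : Matrix ι ι ℝ) (w : κ → ℝ) :
    (vecMulVec w w * (Vᵀ * M * V)).trace = (V *ᵥ w) ⬝ᵥ M *ᵥ (V *ᵥ w) := by
  rw [trace_mul_comm, mul_vecMulVec, trace_vecMulVec, dotProduct_comm, ← mulVec_mulVec,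
    ← mulVec_mulVec, dotProduct_mulVec, vecMul_transpose]

/-- The linear map sending `U` to the vector of the numbers `⟨U, Vᵀ M_e V⟩`; it maps the
spectraplex onto the right-hand side of the formula for the Clarke subdifferential. -/
def compressionTrace {ι κ : Type*} [Fintype ι] [Fintype κ] {m : ℕ} (V : Matrix ι κ ℝ)
    (M : Fin m → Matrix ι ι ℝ) : Matrix κ κ ℝ →ₗ[ℝ] EuclideanSpace ℝ (Fin m) where
  toFun U := WithLp.toLp 2 fun e => (U * (Vᵀ * M e * V)).trace
  map_add' U W := by ext; simp [Matrix.add_mul]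
  map_smul' c U := by ext; simp

variable {n t : ℕ} {X Y : Matrix (Fin n) (Fin n) ℝ} {V : Matrix (Fin n) (Fin t) ℝ} {μ : ℝ}

theorem mulVec_ne_zero_of_transpose_mul_mul_eq_one (hV : Vᵀ * Y * V = 1) {w : Fin t → ℝ}
    (hw : w ≠ 0) : V *ᵥ w ≠ 0 := fun h => hw <| by
  rw [← one_mulVec w, ← hV, ← mulVec_mulVec, h, mulVec_zero]

theorem mulVec_mulVec_eq_smul_of_mul_eq_smul (hVeig : X * V = μ • (Y * V)) (w : Fin t → ℝ) :
    X *ᵥ (V *ᵥ w) = μ • Y *ᵥ (V *ᵥ w) := by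
  rw [mulVec_mulVec, hVeig, smul_mulVec, mulVec_mulVec]

theorem range_mulVecLin_eq_ker (ht : t = genEigenvalueMultiplicity X Y μ)
    (hVeig : X * V = μ • (Y * V)) (hV : Vᵀ * Y * V = 1) :
    LinearMap.range V.mulVecLin = LinearMap.ker (X - μ • Y).mulVecLin := by
  have hinj : Function.Injective V.mulVecLin := by
    rw [← LinearMap.ker_eq_bot, LinearMap.ker_eq_bot']
    exact fun w => not_imp_not.1 (mulVec_ne_zero_of_transpose_mul_mul_eq_one hV)
  refine Submodule.eq_of_le_of_finrank_eq ?_ ?_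
  · rintro _ ⟨w, rfl⟩
    rw [LinearMap.mem_ker, mulVecLin_apply, mulVecLin_apply, sub_mulVec, smul_mulVec,
      mulVec_mulVec_eq_smul_of_mul_eq_smul hVeig, sub_self]
  · rw [LinearMap.finrank_range_of_inj hinj, Module.finrank_fin_fun]
    exact ht

theorem exists_mulVec_eq_iff (ht : t = genEigenvalueMultiplicity X Y μ)
    (hVeig : X * V = μ • (Y * V)) (hV : Vᵀ * Y * V = 1) (v : Fin n → ℝ) :
    (∃ w, V *ᵥ w = v) ↔ X *ᵥ v = μ • Y *ᵥ v := by
  rw [← sub_eq_zero, ← smul_mulVec, ← sub_mulVec]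
  exact SetLike.ext_iff.1 (range_mulVecLin_eq_ker ht hVeig hV) v

/-- The sphere is that of the sup norm, so its eigenvectors and the images `V *ᵥ w` agree only up
to scaling, to which `G` is insensitive. -/
theorem image_unit_eigenvectors_eq (ht : t = genEigenvalueMultiplicity X Y μ)
    (hVeig : X * V = μ • (Y * V)) (hV : Vᵀ * Y * V = 1) {β : Type*} {G : (Fin n → ℝ) → β}
    (hG : ∀ c : ℝ, c ≠ 0 → ∀ v, G (c • v) = G v) :
    G '' {v | v ∈ Metric.sphere 0 1 ∧ X *ᵥ v = μ • Y *ᵥ v} =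
      (fun w => G (V *ᵥ w)) '' {w | w ⬝ᵥ w = 1} := by
  ext g
  constructor
  · rintro ⟨v, ⟨hv, hv_eig⟩, rfl⟩
    obtain ⟨u, rfl⟩ := (exists_mulVec_eq_iff ht hVeig hV v).2 hv_eig
    have hu : u ≠ 0 := by rintro rfl; simp at hv
    have : Nonempty (Fin t) := (Function.ne_iff.1 hu).nonempty
    obtain ⟨w, hw, c, rfl⟩ := exists_dotProduct_self_eq_one_and_smul_eq u
    refine ⟨w, hw, ?_⟩
    simp only [mulVec_smul, hG c (left_ne_zero_of_smul hu)]
  · rintro ⟨w, hw, rfl⟩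
    have hw_ne : w ≠ 0 := by rintro rfl; simp at hw
    have hVw := mulVec_ne_zero_of_transpose_mul_mul_eq_one hV hw_ne
    refine ⟨‖V *ᵥ w‖⁻¹ • V *ᵥ w, ⟨by simp [norm_smul, hVw], ?_⟩,
      hG _ (inv_ne_zero (norm_ne_zero_iff.2 hVw)) _⟩
    rw [← mulVec_smul]
    exact mulVec_mulVec_eq_smul_of_mul_eq_smul hVeig _

theorem genRayleighGradient_mulVec {m : ℕ}
    {A B : EuclideanSpace ℝ (Fin m) → Matrix (Fin n) (Fin n) ℝ} {x : EuclideanSpace ℝ (Fin m)}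
    (hB : (B x).PosDef) (hVeig : A x * V = μ • (B x * V)) (hV : Vᵀ * B x * V = 1) {w : Fin t → ℝ}
    (hw : w ⬝ᵥ w = 1) : genRayleighGradient A B x (V *ᵥ w) =
      compressionTrace V (fun e => matrixPartialDeriv A x e - μ • matrixPartialDeriv B x e)
        (vecMulVec w w) := by
  have hw_ne : w ≠ 0 := by rintro rfl; simp at hw
  have hμ : genRayleigh (A x) (B x) (V *ᵥ w) = μ := genRayleigh_of_eigenvector hB
    (mulVec_ne_zero_of_transpose_mul_mul_eq_one hV hw_ne)
    (mulVec_mulVec_eq_smul_of_mul_eq_smul hVeig w)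
  have hnorm : (V *ᵥ w) ⬝ᵥ B x *ᵥ (V *ᵥ w) = 1 := by
    rw [← trace_vecMulVec_self_mul_compression, hV, mul_one, trace_vecMulVec, hw]
  ext e
  simp only [genRayleighGradient, compressionTrace, hμ, LinearMap.coe_mk, AddHom.coe_mk,
    trace_vecMulVec_self_mul_compression]
  rw [genRayleigh, hnorm, div_one]

end Eigenspace

section ClarkeSubdifferential

variable {m n : ℕ} {A B : EuclideanSpace ℝ (Fin m) → Matrix (Fin n) (Fin n) ℝ}
  {Ω : Set (EuclideanSpace ℝ (Fin m))}

theorem clarkeSubdifferential_maxGenEigenvalueFun_eq_convexHull (hn : 0 < n) (hΩ : IsOpen Ω)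
    (hA : MatrixC1On A Ω) (hB : MatrixC1On B Ω) (hAsymm : ∀ y ∈ Ω, (A y).IsSymm)
    (hBpos : ∀ y ∈ Ω, (B y).PosDef) {x : EuclideanSpace ℝ (Fin m)} (hx : x ∈ Ω) :
    clarkeSubdifferential (maxGenEigenvalueFun A B) x = convexHull ℝ (genRayleighGradient A B x ''
      {v | v ∈ Metric.sphere 0 1 ∧ A x *ᵥ v = maxGenEigenvalueFun A B x • B x *ᵥ v}) := by
  rw [clarkeSubdifferential_eq_convexHull_limitingGradients,
    (isMaxOfC1Family_maxGenEigenvalueFun hn hΩ hA hB hAsymm hBpos).convexHull_limitingGradients hx]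
  refine congrArg (fun s => convexHull ℝ (genRayleighGradient A B x '' s)) ?_
  ext v
  exact and_congr_right fun hv => genRayleigh_eq_maxGenEigenvalue_iff hn (hAsymm x hx)
    (hBpos x hx) (ne_zero_of_mem_unit_sphere ⟨v, hv⟩)

end ClarkeSubdifferential

theorem isOpen_posOrthant (m : ℕ) : IsOpen (posOrthant m) := by
  simp only [posOrthant, Set.ofPred_forall]
  exact isOpen_iInter_of_finite fun e => isOpen_lt continuous_const (by fun_prop)

theorem theorem3_general {m n : ℕ} (hn : 0 < n) {Ω : Set (EuclideanSpace ℝ (Fin m))}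
    (hΩ : IsOpen Ω) (A B : EuclideanSpace ℝ (Fin m) → Matrix (Fin n) (Fin n) ℝ)
    (hA : MatrixC1On A Ω) (hB : MatrixC1On B Ω)
    (hAsymm : ∀ y ∈ Ω, (A y).IsSymm) (hBpos : ∀ y ∈ Ω, (B y).PosDef)
    (x : EuclideanSpace ℝ (Fin m)) (hx : x ∈ Ω)
    (t : ℕ) (ht : t = genEigenvalueMultiplicity (A x) (B x) (maxGenEigenvalueFun A B x))
    (V : Matrix (Fin n) (Fin t) ℝ)
    (hVeig : A x * V = maxGenEigenvalueFun A B x • (B x * V))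
    (hVorth : Vᵀ * B x * V = 1) :
    LocallyLipschitzOn Ω (maxGenEigenvalueFun A B) ∧
    clarkeSubdifferential (maxGenEigenvalueFun A B) x =
      {g | ∃ U ∈ spectraplex t,
        g = WithLp.toLp 2 (fun e : Fin m =>
          (U * (Vᵀ *
            (matrixPartialDeriv A x e - maxGenEigenvalueFun A B x • matrixPartialDeriv B x e) *
              V)).trace)} := by
  refine ⟨(isMaxOfC1Family_maxGenEigenvalueFun hn hΩ hA hB hAsymm hBpos).locallyLipschitzOn, ?_⟩
  set L := compressionTrace V fun e =>
    matrixPartialDeriv A x e - maxGenEigenvalueFun A B x • matrixPartialDeriv B x e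
  calc clarkeSubdifferential (maxGenEigenvalueFun A B) x
    _ = convexHull ℝ (genRayleighGradient A B x '' {v | v ∈ Metric.sphere 0 1 ∧
          A x *ᵥ v = maxGenEigenvalueFun A B x • B x *ᵥ v}) :=
      clarkeSubdifferential_maxGenEigenvalueFun_eq_convexHull hn hΩ hA hB hAsymm hBpos hx
    _ = convexHull ℝ ((fun w => genRayleighGradient A B x (V *ᵥ w)) '' {w | w ⬝ᵥ w = 1}) := by
      rw [image_unit_eigenvectors_eq ht hVeig hVorth fun _ hc => genRayleighGradient_smul hc]
    _ = convexHull ℝ (L '' ((fun w => vecMulVec w w) '' {w | w ⬝ᵥ w = 1})) := by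
      rw [Set.image_image]
      exact congrArg _ (Set.image_congr fun w hw =>
        genRayleighGradient_mulVec (hBpos x hx) hVeig hVorth hw)
    _ = L '' spectraplex t := by rw [← L.image_convexHull, spectraplex_eq_convexHull]
    _ = {g | ∃ U ∈ spectraplex t, g = L U} :=
      Set.ext fun g => exists_congr fun U => and_congr_right fun _ => eq_comm

theorem theorem3 {m n : ℕ} (hn : 0 < n)
    (A B : EuclideanSpace ℝ (Fin m) → Matrix (Fin n) (Fin n) ℝ)
    (hA : MatrixC1On A (posOrthant m)) (hB : MatrixC1On B (posOrthant m))
    (hAsymm : ∀ y ∈ posOrthant m, (A y).IsSymm)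
    (hBpos : ∀ y ∈ posOrthant m, (B y).PosDef)
    (x : EuclideanSpace ℝ (Fin m)) (hx : x ∈ posOrthant m)
    (t : ℕ) (ht : t = genEigenvalueMultiplicity (A x) (B x) (maxGenEigenvalueFun A B x))
    (V : Matrix (Fin n) (Fin t) ℝ)
    (hVeig : A x * V = maxGenEigenvalueFun A B x • (B x * V))
    (hVorth : V.transpose * B x * V = 1) :
    LocallyLipschitzOn (posOrthant m) (maxGenEigenvalueFun A B) ∧
    clarkeSubdifferential (maxGenEigenvalueFun A B) x =
      {g | ∃ U ∈ spectraplex t,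
        g = WithLp.toLp 2 (fun e : Fin m =>
          (U * (V.transpose *
            (matrixPartialDeriv A x e - maxGenEigenvalueFun A B x • matrixPartialDeriv B x e) *
              V)).trace)} :=
  theorem3_general hn (isOpen_posOrthant m) A B hA hB hAsymm hBpos x hx t ht V hVeig hVorth
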